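/- Let $V$ be a finite set and let $\mathcal S=\{A_0=I,A_1,\dots,A_d\}$ be an association scheme on $V$, that is, a set of nonzero symmetric $V\times V$ matrices with entries in $\{0,1\}$ such that $\sum_i A_i=J$ (the all-ones matrix), every $A_i$ with a nonzero diagonal entry is diagonal, and $A_iA_j=\sum_l p_{ij}^l A_l$ for some nonnegative integers $p_{ij}^l$. Write $k_i=p_{ii}^0$ for its degrees, let $E_0=|V|^{-1}J,E_1,\dots,E_d$ be the primitive idempotents of the real span of $\mathcal S$, and let $P$ be the first eigenmatrix, defined by $A_i=\sum_{l=0}^d P_{li}E_l$. Let $$\alpha_{\mathrm{GW}}=\min_{0<\theta\le\pi}\frac{2}{\pi}\,\frac{\theta}{1-\cos\theta}\approx 0.878 .$$ Let $G_1$ and $G_2$ be simple graphs on $V$ whose adjacency matrices are the members $A_{i_1}$ and $A_{i_2}$ of $\mathcal S$ (in the usual labelling, $i_1=1$ and $i_2=2$; $i_1=i_2$ is allowed), and let $$q(x)=\sum_{ij\in E(G_1)}(1-x_ix_j)+\sum_{ij\in E(G_2)}(1+x_ix_j),\qquad \mathrm{qp}(G_1,G_2)=\max\{q(x):x\in\mathbb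 R^V,\ x_i^2=1\ \text{for all } i\in V\}.$$ Put $$B=\frac{|V|}{2}\Bigl((k_{i_1}+k_{i_2})+\max_{0\le l\le d}\{P_{l i_2}-P_{l i_1}\}\Bigr).$$ Then $$\alpha_{\mathrm{GW}}\le\frac{\mathrm{qp}(G_1,G_2)}{B}\le 1 .$$ Moreover, the same bound holds for the corresponding MAX 2-SAT instances: let $x_0\in V$ be an auxiliary vertex and let $\Phi$ be a finite collection of clauses, each a disjunction of at most two literals, over Boolean variables indexed by $V\setminus\{x_0\}$. Suppose that there are real numbers $c>0$ and $b$ such that for every $x\in\{\pm1\}^V$ the number of clauses of $\Phi$ satisfied by the assignment which sets variable $i$ to true if and only if $x_i=x_{x_0}$ equals $b+c\,q(x)$ (for instance $b=0$: all nonzero edge weights in the quadratic model of $\Phi$ are equal to $c$). Then the maximum number $\mathrm{sat}(\Phi)$ of simultaneously satisfiable clauses fulfils $$\alpha_{\mathrm{GW}}\le\frac{\mathrm{sat}(\Phi)-b}{c\,B}\le 1 .$$ -/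

import Mathlib

noncomputable section

/-- A coherent configuration on a finite set `V`, with its matrices enumerated as `A 0, …, A d`:
nonzero `0/1`-matrices summing to the all-ones matrix, closed under transposition, in which a
matrix with a nonzero diagonal entry is diagonal, and with nonnegative integer structure
constants `p i j l`, that is `A i * A j = ∑ l, p i j l • A l`. -/
structure CoherentConfiguration (V : Type*) [Fintype V] [DecidableEq V] (d : ℕ) where
  A : Fin (d + 1) → Matrix V V ℝ
  p : Fin (d + 1) → Fin (d + 1) → Fin (d + 1) → ℕ
  zero_or_one : ∀ i u v, A i u v = 0 ∨ A i u v = 1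
  ne_zero : ∀ i, A i ≠ 0
  sum_eq : ∑ i, A i = Matrix.of fun _ _ => (1 : ℝ)
  transpose_mem : ∀ i, ∃ j, (A i).transpose = A j
  isDiag : ∀ i v, A i v v ≠ 0 → (A i).IsDiag
  mul_eq : ∀ i j, A i * A j = ∑ l, (p i j l : ℝ) • A l

/-- An association scheme `{I, A 1, …, A d}`: a coherent configuration consisting of symmetric
matrices, enumerated so that the identity matrix comes first. -/
structure AssociationScheme (V : Type*) [Fintype V] [DecidableEq V] (d : ℕ) extends
    CoherentConfiguration V d where
  symm : ∀ i, (A i).IsSymm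
  A_zero : A 0 = 1

/-- `E` is a primitive (minimal nonzero) idempotent of the matrix algebra with underlying
space `𝒜`. -/
def IsPrimitiveIdempotentIn {V : Type*} [Fintype V] (𝒜 : Submodule ℝ (Matrix V V ℝ))
    (E : Matrix V V ℝ) : Prop :=
  E ∈ 𝒜 ∧ E ≠ 0 ∧ E * E = E ∧
    ∀ F ∈ 𝒜, F * F = F → F * E = F → E * F = F → F = 0 ∨ F = E

namespace AssociationScheme

variable {V : Type*} [Fintype V] [DecidableEq V] {d : ℕ}

/-- The degrees `k_i = p_{ii}^0` of the scheme. -/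
def degree (S : AssociationScheme V d) (i : Fin (d + 1)) : ℕ := S.p i i 0

/-- The Bose-Mesner algebra: the linear span of the matrices of the scheme. -/
def boseMesner (S : AssociationScheme V d) : Submodule ℝ (Matrix V V ℝ) :=
  Submodule.span ℝ (Set.range S.A)

/-- `E 0, …, E d` is an enumeration, without repetition, of the primitive idempotents of the
Bose-Mesner algebra, with `E 0 = |V|⁻¹ J`. -/
structure IsPrimitiveIdempotents (S : AssociationScheme V d)
    (E : Fin (d + 1) → Matrix V V ℝ) : Prop where
  zero : E 0 = (Fintype.card V : ℝ)⁻¹ • Matrix.of fun _ _ => (1 : ℝ)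
  injective : Function.Injective E
  range_eq : Set.range E = {F | IsPrimitiveIdempotentIn S.boseMesner F}

/-- `P` is the first eigenmatrix of the scheme, for some ordering `E 0 = |V|⁻¹ J, E 1, …, E d`
of the primitive idempotents: `A i = ∑ l, P l i • E l`. -/
def IsFirstEigenmatrix (S : AssociationScheme V d)
    (P : Matrix (Fin (d + 1)) (Fin (d + 1)) ℝ) : Prop :=
  ∃ E : Fin (d + 1) → Matrix V V ℝ, S.IsPrimitiveIdempotents E ∧
    ∀ i, S.A i = ∑ l, P l i • E l

end AssociationScheme

/-- The Goemans-Williamson constant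
`α_GW = min {(2 / π) * θ / (1 - cos θ) : 0 < θ ≤ π} ≈ 0.878`. -/
def alphaGW : ℝ :=
  sInf ((fun θ : ℝ => 2 / Real.pi * (θ / (1 - Real.cos θ))) '' Set.Ioc 0 Real.pi)

section QuadraticProgram

variable {V : Type*} [Fintype V] [DecidableEq V]

/-- `∑_{ij ∈ E₁} (1 - x_i x_j) + ∑_{ij ∈ E₂} (1 + x_i x_j)`. -/
def qpObjective (G₁ G₂ : SimpleGraph V) [DecidableRel G₁.Adj] [DecidableRel G₂.Adj]
    (x : V → ℝ) : ℝ :=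
  ∑ e ∈ G₁.edgeFinset, (1 - (e.map x).mul) + ∑ e ∈ G₂.edgeFinset, (1 + (e.map x).mul)

/-- `qp(G₁, G₂)`, the maximum of the objective over all `x` with `x_i² = 1` for every `i`
(a maximum over a finite nonempty set). -/
def qp (G₁ G₂ : SimpleGraph V) [DecidableRel G₁.Adj] [DecidableRel G₂.Adj] : ℝ :=
  sSup (qpObjective G₁ G₂ '' {x : V → ℝ | ∀ i, x i ^ 2 = 1})

end QuadraticProgram

/-- A clause with at most two literals over the variables `W`. The literal `(w, true)` is the
variable `w`, and `(w, false)` is its negation. -/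
structure TwoClause (W : Type*) where
  literals : Finset (W × Bool)
  card_le : literals.card ≤ 2

/-- The clause (a disjunction) is true under the truth assignment `z`. -/
def TwoClause.Holds {W : Type*} (C : TwoClause W) (z : W → Bool) : Prop :=
  ∃ l ∈ C.literals, z l.1 = l.2

open Classical in
/-- The number of clauses of the instance `Φ` that are true under `z`. -/
def numSatisfied {W : Type*} {m : ℕ} (Φ : Fin m → TwoClause W) (z : W → Bool) : ℕ :=
  (Finset.univ.filter fun j => (Φ j).Holds z).card

/-- The optimal value of MAX 2-SAT on the instance `Φ`. -/
def maxTwoSat {W : Type*} [Fintype W] [DecidableEq W] {m : ℕ} (Φ : Fin m → TwoClause W) : ℕ :=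
  Finset.univ.sup (numSatisfied Φ)

open Classical in
/-- The truth assignment encoded by a sign vector `x` relative to the auxiliary vertex `x₀`:
the variable `i` is true if and only if `x i = x x₀`. -/
def assignmentOf {V : Type*} (x₀ : V) (x : V → ℝ) : {v : V // v ≠ x₀} → Bool :=
  fun i => decide (x i = x x₀)

/-- The MAX 2-SAT instance `Φ`, whose variables are the vertices other than the auxiliary vertex
`x₀`, is modelled by the graphs `G₁, G₂` with constant edge weight `c` and additive constant `b`:
on sign vectors, the number of satisfied clauses is
`b + ∑_{ij ∈ E₁} c (1 - x_i x_j) + ∑_{ij ∈ E₂} c (1 + x_i x_j)`. -/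
def ModelsTwoSat {V : Type*} [Fintype V] [DecidableEq V] (G₁ G₂ : SimpleGraph V)
    [DecidableRel G₁.Adj] [DecidableRel G₂.Adj] (x₀ : V) {m : ℕ}
    (Φ : Fin m → TwoClause {v : V // v ≠ x₀}) (c b : ℝ) : Prop :=
  ∀ x : V → ℝ, (∀ i, x i ^ 2 = 1) →
    (numSatisfied Φ (assignmentOf x₀ x) : ℝ) = b + c * qpObjective G₁ G₂ x

end

/-!
The quadratic program maximises `½ |V| (k₁ + k₂) + ½ xᵀ(A₂ - A₁)x` over sign vectors `x`, where
`A₂ - A₁ = ∑ l, (P l i₂ - P l i₁) • E l`. The primitive idempotents are symmetric, pairwise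
orthogonal, and sum to the identity, so `xᵀ(A₂ - A₁)x` is at most the largest coefficient times
`xᵀx = |V|`. This is the upper bound `qp_le_relaxationValue`.

For the lower bound, let `E l` belong to the largest coefficient. Matrices in the Bose-Mesner
algebra have constant diagonal, so a multiple of `E l` is a positive semidefinite matrix with unit
diagonal, hence the Gram matrix of unit vectors, and the objective at this matrix is exactly the
upper bound. Goemans-Williamson rounding (`alphaGW_mul_le_qp`) turns these vectors into signs
and loses a factor of at most `alphaGW`.

The random hyperplane is the orthogonal complement of a uniform point `g` of the unit ball. That it
separates unit vectors at angle `θ` with probability at least `θ / π` needs no integration: the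
measure is invariant under isometries, so along a half circle the separation probability is an
additive function of the angle (`separationVolume_add`), it is nonnegative, and it equals `1` at
`π`. These properties force the linear bound (`div_mul_le_of_additive`).

If the quadratic program models a MAX 2-SAT instance, the two optima correspond under
`t ↦ b + c * t`, so the ratios agree.
-/

/-! ### Separation of two unit vectors by a random hyperplane -/

open MeasureTheory in
/-- The volume of those points `g` of the open unit ball for which the hyperplane orthogonal to `g`
strictly separates `a` from `b`. -/
noncomputable def separationVolume {E : Type*} [NormedAddCommGroup E] [InnerProductSpace ℝ E]
    [FiniteDimensional ℝ E] [MeasurableSpace E] [BorelSpace E] (a b : E) : ℝ :=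
  volume.real (Metric.ball (0 : E) 1 ∩ {g | inner ℝ a g * inner ℝ b g < 0})

section Separation

open MeasureTheory

variable {E : Type*} [NormedAddCommGroup E] [InnerProductSpace ℝ E]

/-- The point at angle `φ` on the circle through `a` and `b`, meant for orthonormal `a`, `b`. -/
noncomputable def circlePoint (a b : E) (φ : ℝ) : E := Real.cos φ • a + Real.sin φ • b

theorem inner_circlePoint {a b : E} (ha : ‖a‖ = 1) (hb : ‖b‖ = 1) (hab : inner ℝ a b = 0)
    (φ ψ : ℝ) : inner ℝ (circlePoint a b φ) (circlePoint a b ψ) = Real.cos (φ - ψ) := by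
  have hba : inner ℝ b a = 0 := by rw [real_inner_comm, hab]
  simp [circlePoint, inner_add_left, inner_add_right, real_inner_smul_left, real_inner_smul_right,
    hab, hba, ha, hb, Real.cos_sub, mul_comm]

theorem norm_circlePoint {a b : E} (ha : ‖a‖ = 1) (hb : ‖b‖ = 1) (hab : inner ℝ a b = 0)
    (φ : ℝ) : ‖circlePoint a b φ‖ = 1 := by
  have h := inner_circlePoint ha hb hab φ φ
  rw [real_inner_self_eq_norm_sq, sub_self, Real.cos_zero] at h
  exact (pow_eq_one_iff_of_nonneg (norm_nonneg _) two_ne_zero).1 h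

theorem reflection_circlePoint {a b : E} (ha : ‖a‖ = 1) (hb : ‖b‖ = 1) (hab : inner ℝ a b = 0)
    (φ ψ : ℝ) :
    (Submodule.span ℝ {circlePoint a b ψ}).reflection (circlePoint a b φ) =
      circlePoint a b (2 * ψ - φ) := by
  rw [Submodule.reflection_singleton_apply, inner_circlePoint ha hb hab,
    norm_circlePoint ha hb hab]
  have hc : 2 * Real.cos (ψ - φ) * Real.cos ψ - Real.cos φ = Real.cos (2 * ψ - φ) := by
    rw [Real.cos_sub, Real.cos_sub, Real.cos_two_mul, Real.sin_two_mul]; ring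
  have hs : 2 * Real.cos (ψ - φ) * Real.sin ψ - Real.sin φ = Real.sin (2 * ψ - φ) := by
    rw [Real.cos_sub, Real.sin_sub, Real.cos_two_mul, Real.sin_two_mul]
    linear_combination 2 * Real.sin φ * Real.sin_sq_add_cos_sq ψ
  simp only [circlePoint] at *
  rw [← hc, ← hs]
  norm_num
  module

/-- A unit vector `v` lies on the circle through `u` and a suitable `b`, at angle `arccos ⟪u, v⟫`
from `u`. Dimension at least two provides `b` when `v = ±u`. -/
theorem exists_eq_circlePoint_arccos [FiniteDimensional ℝ E] (hE : 2 ≤ Module.finrank ℝ E)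
    {u v : E} (hu : ‖u‖ = 1) (hv : ‖v‖ = 1) :
    ∃ b : E, ‖b‖ = 1 ∧ inner ℝ u b = 0 ∧ v = circlePoint u b (Real.arccos (inner ℝ u v)) := by
  have hu0 : u ≠ 0 := by rintro rfl; simp at hu
  set w : E := v - (inner ℝ u v : ℝ) • u with hw
  have huw : inner ℝ u w = 0 := by
    simp [hw, inner_sub_right, real_inner_smul_right, hu]
  obtain ⟨b, hb, hub, hwb⟩ : ∃ b : E, ‖b‖ = 1 ∧ inner ℝ u b = 0 ∧ w = ‖w‖ • b := by
    by_cases h : w = 0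
    · have h1 := (Submodule.span ℝ {u}).finrank_add_finrank_orthogonal
      rw [finrank_span_singleton hu0] at h1
      have h2 : (Submodule.span ℝ {u})ᗮ ≠ ⊥ := by
        intro h3
        rw [h3, finrank_bot] at h1
        omega
      obtain ⟨x, hx, hx0⟩ := Submodule.exists_mem_ne_zero_of_ne_bot h2
      refine ⟨‖x‖⁻¹ • x, norm_smul_inv_norm (𝕜 := ℝ) hx0, ?_, by simp [h]⟩
      rw [real_inner_smul_right, Submodule.mem_orthogonal_singleton_iff_inner_right.1 hx, mul_zero]
    · refine ⟨‖w‖⁻¹ • w, norm_smul_inv_norm (𝕜 := ℝ) h, ?_, ?_⟩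
      · rw [real_inner_smul_right, huw, mul_zero]
      · rw [smul_inv_smul₀ (norm_ne_zero_iff.2 h)]
  refine ⟨b, hb, hub, ?_⟩
  have habs := abs_real_inner_le_norm u v
  rw [hu, hv, mul_one, abs_le] at habs
  have hnw : ‖w‖ = √(1 - inner ℝ u v ^ 2) := by
    have h : ‖w‖ ^ 2 = 1 - inner ℝ u v ^ 2 := by
      rw [hw, norm_sub_sq_real, norm_smul, real_inner_smul_right, real_inner_comm, hu, hv,
        Real.norm_eq_abs, mul_one, sq_abs]
      ring
    rw [← h, Real.sqrt_sq (norm_nonneg _)]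
  rw [circlePoint, Real.cos_arccos habs.1 habs.2, Real.sin_arccos, ← hnw, ← hwb, hw]
  abel

variable [FiniteDimensional ℝ E] [MeasurableSpace E] [BorelSpace E]

theorem volume_inner_eq_zero {u : E} (hu : u ≠ 0) :
    volume {g : E | inner ℝ u g = 0} = 0 := by
  have h := Measure.addHaar_submodule (volume : Measure E) (Submodule.span ℝ {u})ᗮ (by
    intro h
    have : u ∈ (Submodule.span ℝ {u})ᗮ := h ▸ Submodule.mem_top
    exact hu (inner_self_eq_zero.1 (Submodule.mem_orthogonal_singleton_iff_inner_right.1 this)))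
  convert h using 2
  ext g
  exact Submodule.mem_orthogonal_singleton_iff_inner_right.symm

theorem measurableSet_separating (a b : E) :
    MeasurableSet (Metric.ball (0 : E) 1 ∩ {g | inner ℝ a g * inner ℝ b g < 0}) :=
  measurableSet_ball.inter (measurableSet_lt (by fun_prop) (by fun_prop))

theorem separationVolume_nonneg (a b : E) : 0 ≤ separationVolume a b := measureReal_nonneg

theorem separationVolume_comm (a b : E) : separationVolume a b = separationVolume b a := by
  simp only [separationVolume, mul_comm]

theorem separationVolume_map (f : E ≃ₗᵢ[ℝ] E) (a b : E) :
    separationVolume (f a) (f b) = separationVolume a b := by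
  have h := f.measurePreserving.measureReal_preimage
    (measurableSet_separating (f a) (f b)).nullMeasurableSet
  rw [separationVolume, ← h, separationVolume]
  congr 1
  ext g
  simp

/-- Separation depends only on the difference of angles: the reflection in the line at angle
`(s + t) / 2` maps the points at angles `s` and `s + t` to those at `t` and `0`. -/
theorem separationVolume_circlePoint_add {a b : E} (ha : ‖a‖ = 1) (hb : ‖b‖ = 1)
    (hab : inner ℝ a b = 0) (s t : ℝ) :
    separationVolume (circlePoint a b s) (circlePoint a b (s + t)) =
      separationVolume (circlePoint a b 0) (circlePoint a b t) := by
  rw [separationVolume_comm (circlePoint a b 0), ← separationVolume_map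
    (Submodule.span ℝ {circlePoint a b ((s + t) / 2)}).reflection (circlePoint a b s),
    reflection_circlePoint ha hb hab, reflection_circlePoint ha hb hab]
  congr 2 <;> ring

/-- A hyperplane in general position separates the two ends of an arc of length at most `π` if and
only if it separates exactly one of its two parts. -/
theorem separationVolume_add {a b : E} (ha : ‖a‖ = 1) (hb : ‖b‖ = 1)
    (hab : inner ℝ a b = 0) {s t : ℝ} (hs : 0 ≤ s) (ht : 0 ≤ t) (hst : s + t ≤ Real.pi) :
    separationVolume (circlePoint a b 0) (circlePoint a b (s + t)) =
      separationVolume (circlePoint a b 0) (circlePoint a b s) +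
        separationVolume (circlePoint a b 0) (circlePoint a b t) := by
  rw [← separationVolume_circlePoint_add ha hb hab s t]
  have hne (φ : ℝ) : circlePoint a b φ ≠ 0 := by
    intro h
    have := norm_circlePoint ha hb hab φ
    simp [h] at this
  have hsin (g : E) : Real.sin (s + t) * inner ℝ (circlePoint a b s) g =
      Real.sin t * inner ℝ (circlePoint a b 0) g +
        Real.sin s * inner ℝ (circlePoint a b (s + t)) g := by
    simp only [circlePoint, inner_add_left, real_inner_smul_left, Real.sin_add, Real.cos_add,
      Real.sin_zero, Real.cos_zero]
    linear_combination (Real.sin t * inner ℝ a g) * Real.sin_sq_add_cos_sq s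
  have hst0 := Real.sin_nonneg_of_nonneg_of_le_pi (add_nonneg hs ht) hst
  have hdisj : Disjoint
      (Metric.ball (0 : E) 1 ∩
        {g | inner ℝ (circlePoint a b 0) g * inner ℝ (circlePoint a b s) g < 0})
      (Metric.ball (0 : E) 1 ∩
        {g | inner ℝ (circlePoint a b s) g * inner ℝ (circlePoint a b (s + t)) g < 0}) := by
    rw [Set.disjoint_left]
    rintro g ⟨-, h1⟩ ⟨-, h2⟩
    simp only [Set.mem_ofPred_eq] at h1 h2
    -- The middle vector is a nonnegative combination of the outer two, so it cannot lie on the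
    -- opposite side from both.
    rcases hs.eq_or_lt with rfl | hs'
    · exact (mul_self_nonneg _).not_gt h1
    rcases ht.eq_or_lt with rfl | ht'
    · rw [add_zero] at h2
      exact (mul_self_nonneg _).not_gt h2
    have hs1 := Real.sin_pos_of_pos_of_lt_pi hs' (by linarith)
    have ht1 := Real.sin_pos_of_pos_of_lt_pi ht' (by linarith)
    have h : 0 ≤ Real.sin (s + t) * inner ℝ (circlePoint a b s) g *
        inner ℝ (circlePoint a b s) g := by
      rw [mul_assoc]
      exact mul_nonneg hst0 (mul_self_nonneg _)
    rw [hsin g] at h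
    linarith [mul_neg_of_pos_of_neg hs1 h2, mul_neg_of_pos_of_neg ht1 h1]
  have hbfin : volume (Metric.ball (0 : E) 1) ≠ ⊤ := measure_ball_lt_top.ne
  rw [separationVolume, separationVolume, separationVolume, ← measureReal_union hdisj
    (measurableSet_separating _ _) (measure_inter_ne_top_of_left_ne_top hbfin)
    (measure_inter_ne_top_of_left_ne_top hbfin)]
  refine measureReal_congr (Filter.eventuallyEq_set.2 ?_)
  have h0 (φ : ℝ) : ∀ᵐ g : E, inner ℝ (circlePoint a b φ) g ≠ 0 := by
    rw [ae_iff]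
    simpa using volume_inner_eq_zero (hne φ)
  filter_upwards [h0 0, h0 s, h0 (s + t)] with g g0 gs gt
  have h := (Set.disjoint_left.1 hdisj) (a := g)
  simp only [Set.mem_inter_iff, Set.mem_union, Set.mem_ofPred_eq] at h ⊢
  rw [← and_or_left]
  refine and_congr_right fun hg => ?_
  have h' := fun h1 h2 => h ⟨hg, h1⟩ ⟨hg, h2⟩
  generalize (inner ℝ (circlePoint a b 0) g : ℝ) = p at *
  generalize (inner ℝ (circlePoint a b s) g : ℝ) = q at *
  generalize (inner ℝ (circlePoint a b (s + t)) g : ℝ) = r at *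
  clear hsin h
  rcases g0.lt_or_gt with hp | hp <;> rcases gs.lt_or_gt with hq | hq <;>
    rcases gt.lt_or_gt with hr | hr <;>
    simp [mul_neg_iff, hp, hq, hr, hp.not_gt, hq.not_gt, hr.not_gt] at h' ⊢

theorem separationVolume_circlePoint_pi {a b : E} (ha : ‖a‖ = 1) :
    separationVolume (circlePoint a b 0) (circlePoint a b Real.pi) =
      volume.real (Metric.ball (0 : E) 1) := by
  have ha0 : a ≠ 0 := by rintro rfl; simp at ha
  refine measureReal_congr (Filter.eventuallyEq_set.2 ?_)
  have h0 : ∀ᵐ g : E, inner ℝ a g ≠ 0 := by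
    rw [ae_iff]
    simpa using volume_inner_eq_zero ha0
  filter_upwards [h0] with g hg
  simpa [circlePoint] using fun _ => mul_self_pos.2 hg

/-- An additive nonnegative function on `[0, L]` is at least the linear function with the same
value at `L`. -/
theorem div_mul_le_of_additive {f : ℝ → ℝ} {L : ℝ} (hL : 0 < L) (hf : ∀ t, 0 ≤ f t)
    (hadd : ∀ s t, 0 ≤ s → 0 ≤ t → s + t ≤ L → f (s + t) = f s + f t)
    {t : ℝ} (ht : 0 ≤ t) (htL : t ≤ L) : t / L * f L ≤ f t := by
  have hmul (δ : ℝ) (hδ : 0 ≤ δ) (k : ℕ) (hk : k * δ ≤ L) : f (k * δ) = k * f δ := by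
    induction k with
    | zero => simpa using hadd 0 0 le_rfl le_rfl (by linarith)
    | succ k ih =>
      push_cast at hk ⊢
      rw [add_mul, one_mul, hadd _ _ (by positivity) hδ (by linarith), ih (by linarith)]
      ring
  have hmono (s : ℝ) (hs : 0 ≤ s) (hst : s ≤ t) : f s ≤ f t := by
    have := hadd s (t - s) hs (by linarith) (by linarith)
    rw [add_sub_cancel] at this
    linarith [hf (t - s)]
  -- Compare `t` with the largest multiple of `L / (n + 1)` below it, and let `n` tend to infinity.
  have key (n : ℕ) : (t / L - 1 / (n + 1)) * f L ≤ f t := by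
    have hn : (0 : ℝ) < n + 1 := by positivity
    set δ : ℝ := L / (n + 1) with hδ
    have hδ0 : 0 < δ := by positivity
    have hLδ : L = ((n + 1 : ℕ) : ℝ) * δ := by rw [hδ]; push_cast; field_simp
    have hfL : f L = (n + 1) * f δ := by
      have := hmul δ hδ0.le (n + 1) hLδ.ge
      rw [← hLδ] at this
      push_cast at this
      exact this
    have hk1 : (⌊t / δ⌋₊ : ℝ) * δ ≤ t := (le_div_iff₀ hδ0).1 (Nat.floor_le (by positivity))
    have hk2 : t < (⌊t / δ⌋₊ + 1 : ℝ) * δ := (div_lt_iff₀ hδ0).1 (Nat.lt_floor_add_one _)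
    refine le_trans ?_ (hmono _ (by positivity) hk1)
    rw [hmul δ hδ0.le _ (hk1.trans htL), hfL, ← mul_assoc]
    refine mul_le_mul_of_nonneg_right ?_ (hf δ)
    have h1 : t / L * (n + 1) = t / δ := by rw [hδ]; field_simp
    rw [sub_mul, h1, one_div, inv_mul_cancel₀ hn.ne', sub_le_iff_le_add, div_le_iff₀ hδ0]
    exact hk2.le
  have hlim : Filter.Tendsto (fun n : ℕ => (t / L - 1 / ((n : ℝ) + 1)) * f L) Filter.atTop
      (nhds ((t / L - 0) * f L)) :=
    (tendsto_const_nhds.sub tendsto_one_div_add_atTop_nhds_zero_nat).mul_const _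
  rw [sub_zero] at hlim
  exact le_of_tendsto' hlim key

/-- A random hyperplane through the origin separates two unit vectors with probability at least
(in fact equal to) their angle divided by `π`. -/
theorem arccos_div_pi_mul_le_separationVolume (hE : 2 ≤ Module.finrank ℝ E) {u v : E}
    (hu : ‖u‖ = 1) (hv : ‖v‖ = 1) :
    Real.arccos (inner ℝ u v) / Real.pi * volume.real (Metric.ball (0 : E) 1) ≤
      separationVolume u v := by
  obtain ⟨b, hb, hub, hvb⟩ := exists_eq_circlePoint_arccos hE hu hv
  have h := div_mul_le_of_additive (f := fun t => separationVolume (circlePoint u b 0)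
    (circlePoint u b t)) Real.pi_pos (fun _ => separationVolume_nonneg _ _)
    (fun s t => separationVolume_add hu hb hub) (Real.arccos_nonneg _)
    (Real.arccos_le_pi (inner ℝ u v))
  simp only [separationVolume_circlePoint_pi hu, ← hvb] at h
  simpa [circlePoint] using h

theorem alphaGW_mul_le_arccos_div_pi {y : ℝ} (h₁ : -1 ≤ y) (h₂ : y ≤ 1) :
    alphaGW * (1 - y) ≤ 2 * (Real.arccos y / Real.pi) := by
  rcases h₂.eq_or_lt with rfl | h₂
  · simp
  · have hpos : 0 < Real.arccos y := Real.arccos_pos.2 h₂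
    have h : alphaGW ≤ 2 / Real.pi * (Real.arccos y / (1 - Real.cos (Real.arccos y))) := by
      apply csInf_le
      · refine ⟨0, ?_⟩
        rintro _ ⟨θ, hθ, rfl⟩
        have := Real.cos_le_one θ
        have := Real.pi_pos
        exact mul_nonneg (by positivity) (div_nonneg hθ.1.le (by linarith))
      · exact ⟨_, ⟨hpos, Real.arccos_le_pi y⟩, rfl⟩
    rw [Real.cos_arccos h₁ h₂.le] at h
    have hy : 0 < 1 - y := by linarith
    calc alphaGW * (1 - y) ≤ 2 / Real.pi * (Real.arccos y / (1 - y)) * (1 - y) := by gcongr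
      _ = 2 * (Real.arccos y / Real.pi) := by field_simp

theorem alphaGW_mul_le_separationVolume (hE : 2 ≤ Module.finrank ℝ E) {u v : E}
    (hu : ‖u‖ = 1) (hv : ‖v‖ = 1) :
    alphaGW * (1 - inner ℝ u v) * volume.real (Metric.ball (0 : E) 1) ≤
      2 * separationVolume u v := by
  have habs := abs_real_inner_le_norm u v
  rw [hu, hv, mul_one, abs_le] at habs
  have h := mul_le_mul_of_nonneg_right (alphaGW_mul_le_arccos_div_pi habs.1 habs.2)
    (measureReal_nonneg (μ := volume) (s := Metric.ball (0 : E) 1))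
  linarith [arccos_div_pi_mul_le_separationVolume hE hu hv]

end Separation

/-! ### Hyperplane rounding -/

section Rounding

theorem finite_signVectors (V : Type*) [Finite V] : {x : V → ℝ | ∀ i, x i ^ 2 = 1}.Finite := by
  have h : {x : V → ℝ | ∀ i, x i ^ 2 = 1} = {x | ∀ i, x i ∈ ({1, -1} : Set ℝ)} := by
    ext x
    simp []
  rw [h]
  exact Set.Finite.pi' fun _ => by simp

variable {V : Type*} [Fintype V]
  (G₁ G₂ : SimpleGraph V) [DecidableRel G₁.Adj] [DecidableRel G₂.Adj]

theorem qpObjective_le_qp {x : V → ℝ} (hx : ∀ i, x i ^ 2 = 1) :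
    qpObjective G₁ G₂ x ≤ qp G₁ G₂ :=
  le_csSup ((finite_signVectors V).image _).bddAbove ⟨x, hx, rfl⟩

theorem exists_qpObjective_eq_qp :
    ∃ x : V → ℝ, (∀ i, x i ^ 2 = 1) ∧ qpObjective G₁ G₂ x = qp G₁ G₂ :=
  Set.Nonempty.csSup_mem (s := qpObjective G₁ G₂ '' {x : V → ℝ | ∀ i, x i ^ 2 = 1})
    ⟨_, fun _ => 1, by simp, rfl⟩ ((finite_signVectors V).image _)

variable [DecidableEq V]

theorem SimpleGraph.sum_edgeFinset_eq_half_sum (G : SimpleGraph V) [DecidableRel G.Adj]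
    (f : Sym2 V → ℝ) :
    ∑ e ∈ G.edgeFinset, f e = 1 / 2 * ∑ v, ∑ w, G.adjMatrix ℝ v w * f s(v, w) := by
  have h₁ : ∑ v, ∑ w, G.adjMatrix ℝ v w * f s(v, w) = ∑ d : G.Dart, f d.edge := by
    rw [← Fintype.sum_prod_type' (f := fun v w => G.adjMatrix ℝ v w * f s(v, w))]
    simp only [SimpleGraph.adjMatrix_apply, ite_mul, one_mul, zero_mul]
    rw [← Finset.sum_filter]
    refine (Finset.sum_bij (fun d _ => d.toProd) ?_ ?_ ?_ ?_).symm
    · intro d _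
      simp
    · intro d _ d' _ h
      exact SimpleGraph.Dart.ext _ _ h
    · rintro p hp
      exact ⟨⟨p, by simpa using hp⟩, Finset.mem_univ _, rfl⟩
    · intro d _
      rfl
  have h₂ : ∑ d : G.Dart, f d.edge = ∑ e ∈ G.edgeFinset, 2 * f e := by
    rw [← Finset.sum_fiberwise_of_maps_to (s := Finset.univ) (t := G.edgeFinset)
      (g := SimpleGraph.Dart.edge) (fun d _ => by simp)]
    refine Finset.sum_congr rfl fun e he => ?_
    rw [Finset.sum_congr rfl (fun d hd => by rw [(Finset.mem_filter.1 hd).2]),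
      Finset.sum_const, G.dart_edge_fiber_card e (by simpa using he), nsmul_eq_mul, Nat.cast_ofNat]
  rw [h₁, h₂, ← Finset.mul_sum]
  ring

theorem qpObjective_eq (x : V → ℝ) :
    qpObjective G₁ G₂ x = 1 / 2 * ∑ v, ∑ w, (G₁.adjMatrix ℝ v w * (1 - x v * x w) +
      G₂.adjMatrix ℝ v w * (1 + x v * x w)) := by
  rw [qpObjective, SimpleGraph.sum_edgeFinset_eq_half_sum,
    SimpleGraph.sum_edgeFinset_eq_half_sum, ← mul_add]
  simp only [← Finset.sum_add_distrib]
  rfl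

open MeasureTheory in
/-- Goemans–Williamson rounding: cutting a vector solution of the semidefinite relaxation by a
random hyperplane yields a sign vector whose expected value is at least `alphaGW` times the value
of the relaxation. -/
theorem alphaGW_mul_le_qp {E : Type*} [NormedAddCommGroup E] [InnerProductSpace ℝ E]
    [FiniteDimensional ℝ E] [MeasurableSpace E] [BorelSpace E] (hE : 2 ≤ Module.finrank ℝ E)
    (u : V → E) (hu : ∀ v, ‖u v‖ = 1) :
    alphaGW * (1 / 2 * ∑ v, ∑ w, (G₁.adjMatrix ℝ v w * (1 - inner ℝ (u v) (u w)) +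
      G₂.adjMatrix ℝ v w * (1 + inner ℝ (u v) (u w)))) ≤ qp G₁ G₂ := by
  set M : ℝ := volume.real (Metric.ball (0 : E) 1) with hM
  have hMpos : 0 < M :=
    ENNReal.toReal_pos (Metric.measure_ball_pos _ _ one_pos).ne' measure_ball_lt_top.ne
  let D (a b : E) : Set E := Metric.ball (0 : E) 1 ∩ {g | inner ℝ a g * inner ℝ b g < 0}
  have hint (a b : E) : Integrable ((D a b).indicator (1 : E → ℝ)) :=
    (integrable_indicator_iff (measurableSet_separating a b)).2
      (integrableOn_const (measure_inter_ne_top_of_left_ne_top measure_ball_lt_top.ne))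
  have hval (a b : E) : ∫ g, (D a b).indicator (1 : E → ℝ) g = separationVolume a b :=
    integral_indicator_one (measurableSet_separating a b)
  -- Twice an indicator of separation bounds `1 - x v * x w` from below, and replacing `u w` by
  -- `-u w` gives the same for `1 + x v * x w`, where `x` is the rounded vector.
  let h (g : E) : ℝ := 1 / 2 * ∑ v, ∑ w,
    (G₁.adjMatrix ℝ v w * (2 * (D (u v) (u w)).indicator 1 g) +
      G₂.adjMatrix ℝ v w * (2 * (D (u v) (-u w)).indicator 1 g))
  have hA (G : SimpleGraph V) [DecidableRel G.Adj] (v w : V) : 0 ≤ G.adjMatrix ℝ v w := by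
    rw [SimpleGraph.adjMatrix_apply]
    split_ifs <;> norm_num
  have hle (g : E) : h g ≤ (Metric.ball (0 : E) 1).indicator (fun _ => qp G₁ G₂) g := by
    by_cases hg : g ∈ Metric.ball (0 : E) 1
    · rw [Set.indicator_of_mem hg]
      let x (v : V) : ℝ := if 0 ≤ (inner ℝ (u v) g : ℝ) then 1 else -1
      have hx (v : V) : x v ^ 2 = 1 := by
        simp only [x]
        split_ifs <;> norm_num
      refine le_trans ?_ (qpObjective_le_qp G₁ G₂ hx)
      rw [qpObjective_eq]
      simp only [h]
      gcongr with v _ w _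
      · exact hA _ _ _
      · by_cases hm : g ∈ D (u v) (u w)
        · have hneg := hm.2
          simp only [Set.mem_ofPred_eq] at hneg
          rw [Set.indicator_of_mem hm, Pi.one_apply]
          rcases mul_neg_iff.1 hneg with ⟨h1, h2⟩ | ⟨h1, h2⟩ <;>
            simp only [x, if_pos h1.le, if_neg h2.not_ge, if_pos h2.le, if_neg h1.not_ge] <;>
            norm_num
        · rw [Set.indicator_of_notMem hm]
          nlinarith [hx v, hx w]
      · exact hA _ _ _
      · by_cases hm : g ∈ D (u v) (-u w)
        · have hpos := hm.2
          simp only [Set.mem_ofPred_eq, inner_neg_left, mul_neg, neg_lt_zero] at hpos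
          rw [Set.indicator_of_mem hm, Pi.one_apply]
          rcases mul_pos_iff.1 hpos with ⟨h1, h2⟩ | ⟨h1, h2⟩ <;>
            simp only [x, if_pos h1.le, if_pos h2.le, if_neg h1.not_ge, if_neg h2.not_ge] <;>
            norm_num
        · rw [Set.indicator_of_notMem hm]
          nlinarith [hx v, hx w]
    · simp [h, D, hg]
  have hhint : Integrable h := by
    refine Integrable.const_mul (integrable_finsetSum _ fun v _ => integrable_finsetSum _
      fun w _ => ?_) _
    exact (((hint _ _).const_mul _).const_mul _).add (((hint _ _).const_mul _).const_mul _)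
  have hmono := integral_mono hhint ((integrable_indicator_iff measurableSet_ball).2
    (integrableOn_const measure_ball_lt_top.ne)) hle
  rw [integral_indicator_const _ measurableSet_ball, ← hM, smul_eq_mul] at hmono
  have hinth : ∫ g, h g = 1 / 2 * ∑ v, ∑ w,
      (G₁.adjMatrix ℝ v w * (2 * separationVolume (u v) (u w)) +
        G₂.adjMatrix ℝ v w * (2 * separationVolume (u v) (-u w))) := by
    simp only [h]
    rw [integral_const_mul, integral_finsetSum]
    · congr 1
      refine Finset.sum_congr rfl fun v _ => ?_
      rw [integral_finsetSum]
      · refine Finset.sum_congr rfl fun w _ => ?_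
        rw [integral_add (((hint _ _).const_mul _).const_mul _)
          (((hint _ _).const_mul _).const_mul _)]
        simp only [integral_const_mul, hval]
      · exact fun w _ => (((hint _ _).const_mul _).const_mul _).add
          (((hint _ _).const_mul _).const_mul _)
    · exact fun v _ => integrable_finsetSum _ fun w _ =>
        (((hint _ _).const_mul _).const_mul _).add (((hint _ _).const_mul _).const_mul _)
  rw [hinth] at hmono
  refine le_of_mul_le_mul_left (le_trans ?_ hmono) hMpos
  calc M * (alphaGW * (1 / 2 * ∑ v, ∑ w, (G₁.adjMatrix ℝ v w * (1 - inner ℝ (u v) (u w)) +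
        G₂.adjMatrix ℝ v w * (1 + inner ℝ (u v) (u w)))))
      = 1 / 2 * ∑ v, ∑ w, (G₁.adjMatrix ℝ v w * (alphaGW * (1 - inner ℝ (u v) (u w)) * M) +
        G₂.adjMatrix ℝ v w * (alphaGW * (1 - inner ℝ (u v) (-u w)) * M)) := by
        simp only [Finset.mul_sum, inner_neg_right, sub_neg_eq_add]
        refine Finset.sum_congr rfl fun v _ => Finset.sum_congr rfl fun w _ => ?_
        ring
    _ ≤ _ := by
        refine mul_le_mul_of_nonneg_left (Finset.sum_le_sum fun v _ => Finset.sum_le_sum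
          fun w _ => add_le_add ?_ ?_) one_half_pos.le
        · exact mul_le_mul_of_nonneg_left
            (alphaGW_mul_le_separationVolume hE (hu v) (hu w)) (hA _ _ _)
        · exact mul_le_mul_of_nonneg_left
            (alphaGW_mul_le_separationVolume hE (hu v) (by rw [norm_neg, hu])) (hA _ _ _)

end Rounding

/-! ### Primitive idempotents of the Bose-Mesner algebra -/

namespace AssociationScheme

open Matrix

variable {V : Type*} [Fintype V] [DecidableEq V] {d : ℕ} (S : AssociationScheme V d)

theorem sum_apply (v w : V) : ∑ i, S.A i v w = 1 := by
  have h := congrFun (congrFun S.sum_eq v) w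
  rwa [Matrix.sum_apply, Matrix.of_apply] at h

theorem apply_diag (i : Fin (d + 1)) (v : V) : S.A i v v = if i = 0 then 1 else 0 := by
  split_ifs with hi
  · rw [hi, S.A_zero, Matrix.one_apply_eq]
  · have h := S.sum_apply v v
    rw [Fin.sum_univ_succ, S.A_zero, Matrix.one_apply_eq, add_eq_left,
      Finset.sum_eq_zero_iff_of_nonneg fun j _ => by
        rcases S.zero_or_one j.succ v v with h | h <;> rw [h]; exact zero_le_one] at h
    obtain ⟨j, rfl⟩ := Fin.exists_succ_eq.2 hi
    exact h j (Finset.mem_univ _)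

theorem sum_row (i : Fin (d + 1)) (v : V) : ∑ w, S.A i v w = S.degree i := by
  have h := congrFun (congrFun (S.mul_eq i i) v) v
  rw [Matrix.sum_apply] at h
  simp only [Matrix.smul_apply, S.apply_diag, smul_eq_mul, mul_ite, mul_one, mul_zero,
    Finset.sum_ite_eq', Finset.mem_univ, if_true, Matrix.mul_apply] at h
  rw [degree, ← h]
  refine Finset.sum_congr rfl fun w _ => ?_
  rw [(S.symm i).apply v w]
  rcases S.zero_or_one i v w with h | h <;> simp [h]

theorem isSymm_of_mem {F : Matrix V V ℝ} (hF : F ∈ S.boseMesner) : F.IsSymm := by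
  induction hF using Submodule.span_induction with
  | mem x hx => obtain ⟨i, rfl⟩ := hx; exact S.symm i
  | zero => exact Matrix.isSymm_zero
  | add x y _ _ hx hy => exact hx.add hy
  | smul a x _ hx => exact hx.smul a

theorem diag_eq_of_mem {F : Matrix V V ℝ} (hF : F ∈ S.boseMesner) (v w : V) :
    F v v = F w w := by
  induction hF using Submodule.span_induction with
  | mem x hx => obtain ⟨i, rfl⟩ := hx; rw [S.apply_diag, S.apply_diag]
  | zero => rfl
  | add x y _ _ hx hy => rw [Matrix.add_apply, Matrix.add_apply, hx, hy]
  | smul a x _ hx => rw [Matrix.smul_apply, Matrix.smul_apply, hx]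

theorem mul_mem {F F' : Matrix V V ℝ} (hF : F ∈ S.boseMesner) (hF' : F' ∈ S.boseMesner) :
    F * F' ∈ S.boseMesner := by
  induction hF using Submodule.span_induction with
  | mem x hx =>
    obtain ⟨i, rfl⟩ := hx
    induction hF' using Submodule.span_induction with
    | mem y hy =>
      obtain ⟨j, rfl⟩ := hy
      rw [S.mul_eq]
      exact Submodule.sum_mem _ fun l _ =>
        Submodule.smul_mem _ _ (Submodule.subset_span ⟨l, rfl⟩)
    | zero => rw [mul_zero]; exact Submodule.zero_mem _
    | add x y _ _ hx hy => rw [mul_add]; exact Submodule.add_mem _ hx hy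
    | smul a x _ hx => rw [Matrix.mul_smul]; exact Submodule.smul_mem _ _ hx
  | zero => rw [zero_mul]; exact Submodule.zero_mem _
  | add x y _ _ hx hy => rw [add_mul]; exact Submodule.add_mem _ hx hy
  | smul a x _ hx => rw [Matrix.smul_mul]; exact Submodule.smul_mem _ _ hx

/-- A symmetric product of symmetric matrices forces the factors to commute. -/
theorem mul_comm_of_mem {F F' : Matrix V V ℝ} (hF : F ∈ S.boseMesner)
    (hF' : F' ∈ S.boseMesner) : F * F' = F' * F := by
  have h := S.isSymm_of_mem (S.mul_mem hF hF')
  rw [← h.eq, Matrix.transpose_mul, (S.isSymm_of_mem hF).eq, (S.isSymm_of_mem hF').eq]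

section Idempotents

variable {S} {E : Fin (d + 1) → Matrix V V ℝ}

theorem IsPrimitiveIdempotents.isPrimitiveIdempotentIn (hE : S.IsPrimitiveIdempotents E)
    (l : Fin (d + 1)) : IsPrimitiveIdempotentIn S.boseMesner (E l) := by
  have h : E l ∈ Set.range E := ⟨l, rfl⟩
  rwa [hE.range_eq] at h

theorem IsPrimitiveIdempotents.mem (hE : S.IsPrimitiveIdempotents E) (l : Fin (d + 1)) :
    E l ∈ S.boseMesner := (hE.isPrimitiveIdempotentIn l).1

theorem IsPrimitiveIdempotents.mul_self (hE : S.IsPrimitiveIdempotents E) (l : Fin (d + 1)) :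
    E l * E l = E l := (hE.isPrimitiveIdempotentIn l).2.2.1

/-- The product is an idempotent below both factors, so by minimality it is `0` or equal to both. -/
theorem IsPrimitiveIdempotents.mul_of_ne (hE : S.IsPrimitiveIdempotents E) {l m : Fin (d + 1)}
    (hlm : l ≠ m) : E l * E m = 0 := by
  have hc := S.mul_comm_of_mem (hE.mem l) (hE.mem m)
  have hmem := S.mul_mem (hE.mem l) (hE.mem m)
  have h₁ : E l * E m * E m = E l * E m := by rw [mul_assoc, hE.mul_self]
  have h₂ : E l * (E l * E m) = E l * E m := by rw [← mul_assoc, hE.mul_self]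
  have h₃ : E m * (E l * E m) = E l * E m := by rw [hc, ← mul_assoc, hE.mul_self]
  have h₄ : E l * E m * E l = E l * E m := by rw [hc, mul_assoc, hE.mul_self]
  have hi : E l * E m * (E l * E m) = E l * E m := by rw [← mul_assoc, h₄, h₁]
  rcases (hE.isPrimitiveIdempotentIn l).2.2.2 _ hmem hi h₄ h₂ with h | h
  · exact h
  rcases (hE.isPrimitiveIdempotentIn m).2.2.2 _ hmem hi h₁ h₃ with h' | h'
  · exact h'
  · exact absurd (hE.injective (h.symm.trans h')) hlm

theorem IsPrimitiveIdempotents.mul_of_eq_sum (hE : S.IsPrimitiveIdempotents E)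
    {F : Matrix V V ℝ} {c : Fin (d + 1) → ℝ} (hF : F = ∑ l, c l • E l) (m : Fin (d + 1)) :
    F * E m = c m • E m := by
  rw [hF, Finset.sum_mul, Finset.sum_eq_single m]
  · rw [Matrix.smul_mul, hE.mul_self]
  · intro l _ hl
    rw [Matrix.smul_mul, hE.mul_of_ne hl, smul_zero]
  · simp

theorem IsPrimitiveIdempotents.sum_eq_one (hE : S.IsPrimitiveIdempotents E)
    {c : Fin (d + 1) → ℝ} (hc : (1 : Matrix V V ℝ) = ∑ l, c l • E l) : ∑ l, E l = 1 := by
  rw [hc]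
  refine Finset.sum_congr rfl fun l _ => ?_
  rw [← hE.mul_of_eq_sum hc l, one_mul]

theorem IsPrimitiveIdempotents.dotProduct_mulVec_nonneg (hE : S.IsPrimitiveIdempotents E)
    (l : Fin (d + 1)) (x : V → ℝ) : 0 ≤ x ⬝ᵥ E l *ᵥ x := by
  have h : x ⬝ᵥ E l *ᵥ x = (E l *ᵥ x) ⬝ᵥ (E l *ᵥ x) := by
    conv_lhs => rw [← hE.mul_self l, ← Matrix.mulVec_mulVec, Matrix.dotProduct_mulVec,
      ← Matrix.mulVec_transpose, (S.isSymm_of_mem (hE.mem l)).eq]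
  rw [h]
  exact Finset.sum_nonneg fun v _ => mul_self_nonneg _

theorem IsPrimitiveIdempotents.apply_eq_sum (hE : S.IsPrimitiveIdempotents E)
    (l : Fin (d + 1)) (v w : V) : E l v w = ∑ u, E l v u * E l w u := by
  conv_lhs => rw [← hE.mul_self l, Matrix.mul_apply]
  refine Finset.sum_congr rfl fun u _ => ?_
  rw [(S.isSymm_of_mem (hE.mem l)).apply w u]

theorem IsPrimitiveIdempotents.diag_pos (hE : S.IsPrimitiveIdempotents E)
    (l : Fin (d + 1)) (v : V) : 0 < E l v v := by
  by_contra! h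
  apply (hE.isPrimitiveIdempotentIn l).2.1
  ext w u
  have hw : ∑ u, E l w u * E l w u = 0 := by
    refine le_antisymm ?_ (Finset.sum_nonneg fun u _ => mul_self_nonneg _)
    rwa [← hE.apply_eq_sum, S.diag_eq_of_mem (hE.mem l) w v]
  exact mul_self_eq_zero.1
    ((Finset.sum_eq_zero_iff_of_nonneg fun u _ => mul_self_nonneg _).1 hw u (Finset.mem_univ _))

/-- Scaled to have unit diagonal, a primitive idempotent is the Gram matrix of its own rows. -/
theorem IsPrimitiveIdempotents.exists_gram (hE : S.IsPrimitiveIdempotents E)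
    (l : Fin (d + 1)) (v₀ : V) :
    ∃ u : V → EuclideanSpace ℝ V, (∀ v, ‖u v‖ = 1) ∧
      ∀ v w, inner ℝ (u v) (u w) = (E l v₀ v₀)⁻¹ * E l v w := by
  have hpos := hE.diag_pos l v₀
  let u (v : V) : EuclideanSpace ℝ V := WithLp.toLp 2 fun w => (√(E l v₀ v₀))⁻¹ * E l v w
  have hu (v w : V) : inner ℝ (u v) (u w) = (E l v₀ v₀)⁻¹ * E l v w := by
    rw [hE.apply_eq_sum l v w, Finset.mul_sum, PiLp.inner_apply]
    refine Finset.sum_congr rfl fun z _ => ?_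
    simp only [u, RCLike.inner_apply, conj_trivial]
    rw [← Real.mul_self_sqrt hpos.le, mul_inv, Real.mul_self_sqrt hpos.le]
    ring
  refine ⟨u, fun v => ?_, hu⟩
  have h := hu v v
  rw [S.diag_eq_of_mem (hE.mem l) v v₀, inv_mul_cancel₀ hpos.ne', real_inner_self_eq_norm_sq] at h
  exact (pow_eq_one_iff_of_nonneg (norm_nonneg _) two_ne_zero).1 h

end Idempotents

end AssociationScheme

/-! ### Bounds on the quadratic program -/

namespace AssociationScheme

open Matrix

variable {V : Type*} [Fintype V] [DecidableEq V] {d : ℕ} {S : AssociationScheme V d}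

theorem sum_sum_mul_eq_trace_mul {W : Type*} [Fintype W] {M F : Matrix W W ℝ} (hF : F.IsSymm) :
    ∑ v, ∑ w, M v w * F v w = (M * F).trace := by
  simp only [Matrix.trace, Matrix.diag, Matrix.mul_apply]
  refine Finset.sum_congr rfl fun v _ => Finset.sum_congr rfl fun w _ => ?_
  rw [hF.apply w v]

/-- The objective at a Gram matrix `X`, split into the number of edges and the part depending
on `X`. -/
theorem half_sum_sum_eq (S : AssociationScheme V d) (i₁ i₂ : Fin (d + 1)) (X : V → V → ℝ) :
    1 / 2 * ∑ v, ∑ w, (S.A i₁ v w * (1 - X v w) + S.A i₂ v w * (1 + X v w)) =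
      1 / 2 * ((Fintype.card V : ℝ) * (S.degree i₁ + S.degree i₂) +
        ∑ v, ∑ w, (S.A i₂ - S.A i₁) v w * X v w) := by
  have h (i : Fin (d + 1)) : ∑ v, ∑ w, S.A i v w = (Fintype.card V : ℝ) * S.degree i := by
    simp [S.sum_row]
  rw [mul_add (Fintype.card V : ℝ), ← h, ← h]
  simp only [← Finset.sum_add_distrib]
  congr 1
  refine Finset.sum_congr rfl fun v _ => Finset.sum_congr rfl fun w _ => ?_
  rw [Matrix.sub_apply]
  ring

theorem IsPrimitiveIdempotents.dotProduct_mulVec_le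
    {E : Fin (d + 1) → Matrix V V ℝ} (hE : S.IsPrimitiveIdempotents E)
    {c : Fin (d + 1) → ℝ} {F : Matrix V V ℝ} (hF : F = ∑ l, c l • E l) (h1 : ∑ l, E l = 1)
    {b : ℝ} (hb : ∀ l, c l ≤ b) (x : V → ℝ) : x ⬝ᵥ F *ᵥ x ≤ b * (x ⬝ᵥ x) := by
  have hsum : x ⬝ᵥ x = ∑ l, x ⬝ᵥ E l *ᵥ x := by
    rw [← dotProduct_sum, ← Matrix.sum_mulVec, h1, Matrix.one_mulVec]
  rw [hF, Matrix.sum_mulVec, dotProduct_sum, hsum, Finset.mul_sum]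
  refine Finset.sum_le_sum fun l _ => ?_
  rw [Matrix.smul_mulVec, dotProduct_smul, smul_eq_mul]
  exact mul_le_mul_of_nonneg_right (hb l) (hE.dotProduct_mulVec_nonneg l x)

variable {P : Matrix (Fin (d + 1)) (Fin (d + 1)) ℝ} {G₁ G₂ : SimpleGraph V}
  [DecidableRel G₁.Adj] [DecidableRel G₂.Adj] {i₁ i₂ : Fin (d + 1)}

/-- On fewer than two vertices a simple graph has no edges, but `S.A i₁` is nonzero. -/
theorem card_ge_two (h : S.A i₁ = G₁.adjMatrix ℝ) : 2 ≤ Fintype.card V := by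
  by_contra! hc
  have : Subsingleton V := Fintype.card_le_one_iff_subsingleton.1 (by omega)
  apply S.ne_zero i₁
  ext v w
  rw [h, Subsingleton.elim w v]
  simp

/-- The value `B` of the semidefinite relaxation of the quadratic program, in the closed form
which the eigenmatrix `P` provides. -/
noncomputable def relaxationValue (S : AssociationScheme V d)
    (P : Matrix (Fin (d + 1)) (Fin (d + 1)) ℝ) (i₁ i₂ : Fin (d + 1)) : ℝ :=
  (Fintype.card V : ℝ) / 2 * (((S.degree i₁ : ℝ) + (S.degree i₂ : ℝ)) +
    Finset.univ.sup' Finset.univ_nonempty fun l => P l i₂ - P l i₁)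

theorem sub_eq_sum {E : Fin (d + 1) → Matrix V V ℝ} (hA : ∀ i, S.A i = ∑ l, P l i • E l)
    (i₁ i₂ : Fin (d + 1)) : S.A i₂ - S.A i₁ = ∑ l, (P l i₂ - P l i₁) • E l := by
  rw [hA, hA, ← Finset.sum_sub_distrib]
  simp only [sub_smul]

theorem qpObjective_le_relaxationValue (hP : S.IsFirstEigenmatrix P)
    (h₁ : S.A i₁ = G₁.adjMatrix ℝ) (h₂ : S.A i₂ = G₂.adjMatrix ℝ) {x : V → ℝ}
    (hx : ∀ v, x v ^ 2 = 1) : qpObjective G₁ G₂ x ≤ S.relaxationValue P i₁ i₂ := by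
  obtain ⟨E, hE, hA⟩ := hP
  have h := hE.dotProduct_mulVec_le (sub_eq_sum hA i₁ i₂)
    (hE.sum_eq_one (by rw [← S.A_zero]; exact hA 0))
    (b := Finset.univ.sup' Finset.univ_nonempty fun l => P l i₂ - P l i₁)
    (fun l => Finset.le_sup' (fun l => P l i₂ - P l i₁) (Finset.mem_univ l)) x
  have hxx : x ⬝ᵥ x = Fintype.card V := by simp [dotProduct, ← pow_two, hx]
  have hq : x ⬝ᵥ (S.A i₂ - S.A i₁) *ᵥ x =
      ∑ v, ∑ w, (S.A i₂ - S.A i₁) v w * (x v * x w) := by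
    simp only [dotProduct, Matrix.mulVec, Finset.mul_sum]
    refine Finset.sum_congr rfl fun v _ => Finset.sum_congr rfl fun w _ => ?_
    ring
  rw [qpObjective_eq, ← h₁, ← h₂, S.half_sum_sum_eq i₁ i₂ fun v w => x v * x w, relaxationValue]
  rw [hq, hxx] at h
  linarith

theorem qp_le_relaxationValue (hP : S.IsFirstEigenmatrix P)
    (h₁ : S.A i₁ = G₁.adjMatrix ℝ) (h₂ : S.A i₂ = G₂.adjMatrix ℝ) :
    qp G₁ G₂ ≤ S.relaxationValue P i₁ i₂ := by
  obtain ⟨x, hx, hq⟩ := exists_qpObjective_eq_qp G₁ G₂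
  exact hq ▸ qpObjective_le_relaxationValue hP h₁ h₂ hx

/-- The relaxation value is at least the objective at the all-ones vector, which is twice the
number of edges of `G₂`. -/
theorem relaxationValue_pos (hP : S.IsFirstEigenmatrix P)
    (h₁ : S.A i₁ = G₁.adjMatrix ℝ) (h₂ : S.A i₂ = G₂.adjMatrix ℝ) :
    0 < S.relaxationValue P i₁ i₂ := by
  refine lt_of_lt_of_le ?_
    (qpObjective_le_relaxationValue hP h₁ h₂ (x := fun _ => 1) (by simp))
  rw [qpObjective_eq, ← h₂]
  norm_num
  have hnn (v w : V) : 0 ≤ S.A i₂ v w := by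
    rcases S.zero_or_one i₂ v w with h | h <;> simp [h]
  obtain ⟨v, w, hvw⟩ : ∃ v w, S.A i₂ v w ≠ 0 := by
    by_contra! h
    exact S.ne_zero i₂ (Matrix.ext h)
  have hpos := (hnn v w).lt_of_ne' hvw
  exact Finset.sum_pos' (fun v _ => Finset.sum_nonneg fun w _ => by linarith [hnn v w])
    ⟨v, Finset.mem_univ _, Finset.sum_pos' (fun w _ => by linarith [hnn v w])
      ⟨w, Finset.mem_univ _, by linarith⟩⟩

/-- An idempotent belonging to the largest value of `P l i₂ - P l i₁`, scaled to have unit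
diagonal, is feasible for the semidefinite relaxation and attains its value; then round. -/
theorem alphaGW_mul_relaxationValue_le_qp (hP : S.IsFirstEigenmatrix P)
    (h₁ : S.A i₁ = G₁.adjMatrix ℝ) (h₂ : S.A i₂ = G₂.adjMatrix ℝ) :
    alphaGW * S.relaxationValue P i₁ i₂ ≤ qp G₁ G₂ := by
  obtain ⟨E, hE, hA⟩ := hP
  have hcard := card_ge_two h₁
  obtain ⟨v₀⟩ : Nonempty V := Fintype.card_pos_iff.1 (by omega)
  obtain ⟨l, -, hl⟩ := Finset.exists_mem_eq_sup' Finset.univ_nonempty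
    fun l => P l i₂ - P l i₁
  obtain ⟨u, hu, hinner⟩ := hE.exists_gram l v₀
  have h := alphaGW_mul_le_qp G₁ G₂ (by rwa [finrank_euclideanSpace]) u hu
  have hpos := hE.diag_pos l v₀
  have htr : (E l).trace = Fintype.card V * E l v₀ v₀ := by
    simp [Matrix.trace, S.diag_eq_of_mem (hE.mem l) _ v₀]
  have hsum : ∑ v, ∑ w, (S.A i₂ - S.A i₁) v w * inner ℝ (u v) (u w) =
      Fintype.card V * (P l i₂ - P l i₁) := by
    simp only [hinner, mul_left_comm _ (E l v₀ v₀)⁻¹, ← Finset.mul_sum]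
    rw [sum_sum_mul_eq_trace_mul (S.isSymm_of_mem (hE.mem l)),
      hE.mul_of_eq_sum (sub_eq_sum hA i₁ i₂), Matrix.trace_smul, htr, smul_eq_mul]
    field_simp
  rw [← h₁, ← h₂, S.half_sum_sum_eq i₁ i₂ fun v w => inner ℝ (u v) (u w), hsum] at h
  rw [relaxationValue, hl]
  convert h using 2
  ring

end AssociationScheme

/-! ### MAX 2-SAT instances -/

section TwoSat

theorem exists_assignmentOf_eq {V : Type*} [DecidableEq V] (x₀ : V) (z : {v : V // v ≠ x₀} → Bool) :
    ∃ x : V → ℝ, (∀ v, x v ^ 2 = 1) ∧ assignmentOf x₀ x = z := by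
  refine ⟨fun v => if h : v ≠ x₀ then (if z ⟨v, h⟩ then 1 else -1) else 1, fun v => ?_, ?_⟩
  · dsimp only
    split_ifs <;> norm_num
  · funext i
    have hi := i.2
    simp only [assignmentOf, dif_pos hi]
    cases z i <;> norm_num

variable {V : Type*} [Fintype V] [DecidableEq V] {G₁ G₂ : SimpleGraph V}
  [DecidableRel G₁.Adj] [DecidableRel G₂.Adj]

/-- Every truth assignment comes from a sign vector, so the optima correspond under the affine
map relating the two objectives. -/
theorem ModelsTwoSat.maxTwoSat_eq {x₀ : V} {m : ℕ} {Φ : Fin m → TwoClause {v : V // v ≠ x₀}}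
    {c b : ℝ} (h : ModelsTwoSat G₁ G₂ x₀ Φ c b) (hc : 0 < c) :
    (maxTwoSat Φ : ℝ) = b + c * qp G₁ G₂ := by
  apply le_antisymm
  · obtain ⟨z, -, hz⟩ := Finset.exists_mem_eq_sup (Finset.univ) Finset.univ_nonempty
      (numSatisfied Φ)
    obtain ⟨x, hx, rfl⟩ := exists_assignmentOf_eq x₀ z
    rw [maxTwoSat, hz, h x hx]
    gcongr
    exact qpObjective_le_qp G₁ G₂ hx
  · obtain ⟨x, hx, hq⟩ := exists_qpObjective_eq_qp G₁ G₂
    rw [← hq, ← h x hx]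
    exact_mod_cast Finset.le_sup (Finset.mem_univ _)

end TwoSat

theorem mainTheorem6 {V : Type*} [Fintype V] [DecidableEq V] {d : ℕ}
    (S : AssociationScheme V d) (P : Matrix (Fin (d + 1)) (Fin (d + 1)) ℝ)
    (hP : S.IsFirstEigenmatrix P)
    (G₁ G₂ : SimpleGraph V) [DecidableRel G₁.Adj] [DecidableRel G₂.Adj]
    (i₁ i₂ : Fin (d + 1)) (h₁ : S.A i₁ = G₁.adjMatrix ℝ) (h₂ : S.A i₂ = G₂.adjMatrix ℝ) :
    (alphaGW ≤ qp G₁ G₂ / ((Fintype.card V : ℝ) / 2 *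
        (((S.degree i₁ : ℝ) + (S.degree i₂ : ℝ)) +
          Finset.univ.sup' Finset.univ_nonempty fun l => P l i₂ - P l i₁)) ∧
      qp G₁ G₂ / ((Fintype.card V : ℝ) / 2 *
        (((S.degree i₁ : ℝ) + (S.degree i₂ : ℝ)) +
          Finset.univ.sup' Finset.univ_nonempty fun l => P l i₂ - P l i₁)) ≤ 1) ∧
    ∀ (x₀ : V) (m : ℕ) (Φ : Fin m → TwoClause {v : V // v ≠ x₀}) (c b : ℝ),
      0 < c → ModelsTwoSat G₁ G₂ x₀ Φ c b →
      alphaGW ≤ ((maxTwoSat Φ : ℝ) - b) / (c * ((Fintype.card V : ℝ) / 2 *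
          (((S.degree i₁ : ℝ) + (S.degree i₂ : ℝ)) +
            Finset.univ.sup' Finset.univ_nonempty fun l => P l i₂ - P l i₁))) ∧
        ((maxTwoSat Φ : ℝ) - b) / (c * ((Fintype.card V : ℝ) / 2 *
          (((S.degree i₁ : ℝ) + (S.degree i₂ : ℝ)) +
            Finset.univ.sup' Finset.univ_nonempty fun l => P l i₂ - P l i₁))) ≤ 1 := by
  have hpos := AssociationScheme.relaxationValue_pos hP h₁ h₂
  have hlow := (le_div_iff₀ hpos).2 (AssociationScheme.alphaGW_mul_relaxationValue_le_qp hP h₁ h₂)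
  have hupp := (div_le_one₀ hpos).2 (AssociationScheme.qp_le_relaxationValue hP h₁ h₂)
  refine ⟨⟨hlow, hupp⟩, fun x₀ m Φ c b hc hΦ => ?_⟩
  rw [hΦ.maxTwoSat_eq hc, add_sub_cancel_left, mul_div_mul_left _ _ hc.ne']
  exact ⟨hlow, hupp⟩
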